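/- For a semigroup $S$ (written multiplicatively), let $I(S)$ be the smallest positive integer $t$ such that every sequence of $t$ (not necessarily distinct) elements of $S$ has a nonempty subsequence whose terms, multiplied in order, give an idempotent element, i.e. an $x$ with $x^2=x$ (and $I(S)=\infty$ if there is no such $t$). For a commutative ring $R$, let $I_r(R)$ be $I(S)$ for $S$ the multiplicative semigroup of $R$. For a finite abelian group $G$ (written multiplicatively), let $\mathsf{D}(G)$ be the Davenport constant: the smallest positive integer $t$ such that every sequence of $t$ elements of $G$ has a nonempty subsequence whose product is the identity. Let $n=2p^kq^{\ell}$, where $p$ and $q$ are distinct odd primes and $k,\ell\ge 1$ are integers. Then $$I_r(\mathbb{Z}/n\mathbb{Z})=\mathsf{D}\big((\mathbb{Z}/n\mathbb{Z})^{\times}\big)+(k-1)+(\ell-1).$$ -/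

import Mathlib

/-- A sequence `l` over a multiplicative semigroup has a nonempty subsequence (in the given order)
whose terms multiply to an idempotent element. The nonempty subsequence is written `a :: t`, and its
product `(⋯((a * t₁) * t₂) * ⋯)` is formed without an identity element. -/
def HasIdempotentSubproduct {S : Type*} [Semigroup S] (l : List S) : Prop :=
  ∃ (a : S) (t : List S), (a :: t).Sublist l ∧ IsIdempotentElem (t.foldl (· * ·) a)

/-- The Erdős–Burgess constant `I(S)` of a multiplicative semigroup `S`: the smallest positive
integer `k` such that every sequence of `k` elements of `S` has a nonempty subsequence whose terms
multiply to an idempotent, and `⊤` if there is no such `k`. -/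
noncomputable def erdosBurgess (S : Type*) [Semigroup S] : ℕ∞ :=
  sInf ((fun k : ℕ => (k : ℕ∞)) ''
    {k : ℕ | 0 < k ∧ ∀ l : List S, l.length = k → HasIdempotentSubproduct l})

/-- `I_r(R)`: the Erdős–Burgess constant of the multiplicative semigroup of the commutative
ring `R`. -/
noncomputable def ringErdosBurgess (R : Type*) [CommRing R] : ℕ∞ :=
  erdosBurgess R

/-- A sequence `l` over an abelian group (written multiplicatively) has a nonempty subsequence
with product `1`. -/
def HasTrivialSubproduct {G : Type*} [CommGroup G] (l : List G) : Prop :=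
  ∃ t : List G, t ≠ [] ∧ t.Sublist l ∧ t.prod = 1

/-- Every sequence of `|G|` elements of a finite abelian group `G` has a nonempty subsequence with
product `1`, so the minimum in the definition of the Davenport constant is over a nonempty set. -/
theorem exists_davenport_bound (G : Type*) [CommGroup G] [Finite G] :
    ∃ k : ℕ, 0 < k ∧ ∀ l : List G, l.length = k → HasTrivialSubproduct l := by
  have := Fintype.ofFinite G
  refine ⟨Fintype.card G, Fintype.card_pos, fun l hl => ?_⟩
  obtain ⟨i, j, hij, h⟩ := Fintype.exists_ne_map_eq_of_card_lt
    (fun i : Fin (Fintype.card G + 1) => (l.take i).prod) (by simp)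
  wlog hlt : i < j generalizing i j
  · exact this j i hij.symm h.symm (lt_of_le_of_ne (not_lt.mp hlt) hij.symm)
  have hlt' : (i : ℕ) < j := hlt
  have hj : (j : ℕ) ≤ l.length := by have := j.2; omega
  refine ⟨(l.take j).drop i, ?_, (List.drop_sublist _ _).trans (List.take_sublist _ _), ?_⟩
  · intro h0
    have := congrArg List.length h0
    simp at this
    omega
  · have h1 := List.prod_take_mul_prod_drop (l.take j) i
    rw [List.take_take, min_eq_left hlt'.le] at h1
    rw [h] at h1
    exact mul_eq_left.mp h1

open Classical in
/-- The Davenport constant `D(G)` of a finite abelian group `G` (written multiplicatively): the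
smallest positive integer `k` such that every sequence of `k` elements of `G` has a nonempty
subsequence whose product is the identity. -/
noncomputable def davenport (G : Type*) [CommGroup G] [Finite G] : ℕ :=
  Nat.find (exists_davenport_bound G)

theorem davenport_isLeast (G : Type*) [CommGroup G] [Finite G] :
    IsLeast {k : ℕ | 0 < k ∧ ∀ l : List G, l.length = k → HasTrivialSubproduct l}
      (davenport G) := by
  classical
  exact ⟨Nat.find_spec (exists_davenport_bound G),
    fun _ hm => Nat.find_min' (exists_davenport_bound G) hm⟩

/-! Everything is idempotent modulo 2, so idempotency is tested modulo p^k and q^ℓ. The lower bound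
adjoins k - 1 copies of p and ℓ - 1 copies of q to a longest product-one free sequence of units.

For the upper bound, if at least k terms are nonunits modulo p^k and at least ℓ modulo q^ℓ, the full
product vanishes modulo both. Otherwise, by symmetry, at least D + k - 1 terms are units modulo q^ℓ,
where D is the Davenport constant of the unit group. Let A be those that are also units modulo p^k,
and B the rest. If lifts of A to units modulo n have a product-one subsequence, it suffices. If not,
`exists_prod_eq_one_of_davenport_add_le` finds a product equal to 1 modulo q^ℓ with at least k terms
of B, hence 0 modulo p^k.

That lemma works in the cyclic group G of units modulo q^ℓ. Let K stabilize the set of subproducts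
of A. The terms of A in K number at most D - [G : K] (`card_add_index_le_davenport`), while each
term of A outside K enlarges the set of subproducts by |K|
(`card_stabilizer_mul_le_card_subsetProds`). So few terms of B are needed before the set stops
growing. The total product is then attained using only A and those few terms, and the complementary
subsequence has product 1 and contains the rest of B. -/

open Classical in
/-- The set of products of `v` over the subsets of `s`. -/
noncomputable def subsetProds {ι G : Type*} [CommMonoid G] (v : ι → G) (s : Finset ι) : Finset G :=
  s.powerset.image fun t => ∏ i ∈ t, v i

/-! ### Growth of sets of subproducts -/

section SubsetProds

open scoped Pointwise

variable {ι G : Type*} [CommGroup G] {v : ι → G}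

theorem mem_subsetProds {s : Finset ι} {g : G} :
    g ∈ subsetProds v s ↔ ∃ t ⊆ s, ∏ i ∈ t, v i = g := by
  simp [subsetProds]

theorem prod_mem_subsetProds (s : Finset ι) : ∏ i ∈ s, v i ∈ subsetProds v s :=
  mem_subsetProds.2 ⟨s, subset_rfl, rfl⟩

variable [DecidableEq G]

theorem subsetProds_singleton (i : ι) : subsetProds v {i} = {1, v i} := by
  ext g
  simp [mem_subsetProds, Finset.subset_singleton_iff, eq_comm]

variable [DecidableEq ι]

theorem subsetProds_union {s t : Finset ι} (h : Disjoint s t) :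
    subsetProds v (s ∪ t) = subsetProds v s * subsetProds v t := by
  ext g
  simp only [Finset.mem_mul, mem_subsetProds]
  constructor
  · rintro ⟨r, hr, rfl⟩
    refine ⟨_, ⟨r ∩ s, Finset.inter_subset_right, rfl⟩, _, ⟨r ∩ t, Finset.inter_subset_right, rfl⟩,
      ?_⟩
    rw [← Finset.prod_union (h.mono Finset.inter_subset_right Finset.inter_subset_right),
      ← Finset.inter_union_distrib_left, Finset.inter_eq_left.2 hr]
  · rintro ⟨_, ⟨a, ha, rfl⟩, _, ⟨b, hb, rfl⟩, rfl⟩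
    exact ⟨a ∪ b, Finset.union_subset_union ha hb, Finset.prod_union (h.mono ha hb)⟩

theorem mul_subsetProds_insert (X : Finset G) {i : ι} {s : Finset ι} (hi : i ∉ s) :
    X * subsetProds v (insert i s) = X * subsetProds v s ∪ v i • (X * subsetProds v s) := by
  have h : insert i s = s ∪ {i} := by rw [Finset.union_comm]; rfl
  rw [h, subsetProds_union (by simpa using hi), subsetProds_singleton, ← mul_assoc]
  rw [Finset.insert_eq, Finset.mul_union, Finset.mul_singleton, Finset.mul_singleton]
  simp only [op_smul_eq_smul, one_smul]

theorem stabilizer_le_stabilizer_mul (X Y : Finset G) :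
    MulAction.stabilizer G X ≤ MulAction.stabilizer G (X * Y) := by
  intro g hg
  rw [MulAction.mem_stabilizer_iff] at hg ⊢
  rw [← smul_mul_assoc, hg]

variable [Finite G]

/-- Since `X` and `g • X` have equal size, `g • X` has a point outside `X`; both are unions of
`K`-cosets, so the whole coset of that point is new. -/
theorem card_add_card_le_card_union_smul {K : Subgroup G} {X : Finset G}
    (hK : K ≤ MulAction.stabilizer G X) {g : G} (hg : g ∉ MulAction.stabilizer G X) :
    X.card + Nat.card K ≤ (X ∪ g • X).card := by
  have hst : ∀ k ∈ K, ∀ x, k * x ∈ X ↔ x ∈ X := by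
    intro k hk x
    have h := MulAction.mem_stabilizer_iff.1 (hK hk)
    conv_lhs => rw [← h]
    exact Finset.smul_mem_smul_finset_iff (b := x) (s := X) k
  obtain ⟨z, hz, hzX⟩ : ∃ z ∈ g • X, z ∉ X := by
    by_contra! h
    exact hg (MulAction.mem_stabilizer_iff.2
      (Finset.eq_of_subset_of_card_le h (by rw [Finset.card_smul_finset])))
  rw [← Finset.union_sdiff_self_eq_union, Finset.card_union_of_disjoint Finset.disjoint_sdiff]
  have := Fintype.ofFinite K
  rw [Nat.card_eq_fintype_card, ← Finset.card_univ]
  gcongr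
  refine Finset.card_le_card_of_injOn (fun k : K => (k : G) * z) ?_ ?_
  · intro k _
    obtain ⟨x, hx, rfl⟩ := Finset.mem_smul_finset.1 hz
    simp only [Finset.coe_sdiff, Set.mem_sdiff, Finset.mem_coe]
    refine ⟨Finset.mem_smul_finset.2 ⟨k * x, (hst k k.2 x).2 hx, ?_⟩, fun h => hzX ?_⟩
    · simp only [smul_eq_mul]; exact mul_left_comm _ _ _
    · exact (hst k k.2 _).1 h
  · intro a _ b _ h
    exact Subtype.ext (mul_right_cancel h)

/-- Adjoining terms of a sequence as long as the set of partial products grows. -/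
theorem exists_subset_stabilizing {K : Subgroup G} {X : Finset G}
    (hK : K ≤ MulAction.stabilizer G X) (v : ι → G) (B : Finset ι) :
    ∃ W ⊆ B, (∀ i ∈ B \ W, v i ∈ MulAction.stabilizer G (X * subsetProds v W)) ∧
      X.card + Nat.card K * W.card ≤ (X * subsetProds v W).card := by
  set F := B.powerset.filter fun W =>
    X.card + Nat.card K * W.card ≤ (X * subsetProds v W).card with hF
  have h0 : ∅ ∈ F := by
    have h1 : subsetProds v ∅ = 1 := by
      simp [subsetProds, ← Finset.singleton_one]
    simp [hF, h1]
  obtain ⟨W, hW, hmax⟩ := F.exists_max_image Finset.card ⟨_, h0⟩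
  rw [hF, Finset.mem_filter, Finset.mem_powerset] at hW
  refine ⟨W, hW.1, fun i hi => ?_, hW.2⟩
  rw [Finset.mem_sdiff] at hi
  by_contra hv
  have hg := card_add_card_le_card_union_smul
    (hK.trans (stabilizer_le_stabilizer_mul X (subsetProds v W))) hv
  rw [← mul_subsetProds_insert X hi.2] at hg
  have := hmax (insert i W) (by
    rw [hF, Finset.mem_filter, Finset.mem_powerset]
    refine ⟨Finset.insert_subset hi.1 hW.1, ?_⟩
    rw [Finset.card_insert_of_notMem hi.2]
    linarith [hW.2])
  rw [Finset.card_insert_of_notMem hi.2] at this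
  omega

/-- A case of Kneser's theorem: the set of partial products `X` of a sequence satisfies
`|X| ≥ (N + 1)|K|`, where `K` is its stabilizer and `N` counts the terms outside `K`. -/
theorem card_stabilizer_mul_le_card_subsetProds (v : ι → G) (A : Finset ι) (N : Finset ι)
    (hNA : N ⊆ A) (hN : ∀ i ∈ N, v i ∉ MulAction.stabilizer G (subsetProds v A)) :
    Nat.card (MulAction.stabilizer G (subsetProds v A)) * (N.card + 1) ≤
      (subsetProds v A).card := by
  have := Fintype.ofFinite G
  classical
  set K := MulAction.stabilizer G (subsetProds v A) with hKdef
  -- Starting the growth from `K` itself, rather than from 1, makes every step gain `|K|`.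
  set X : Finset G := Finset.univ.filter (· ∈ K) with hX
  have hXcard : X.card = Nat.card K := by
    rw [hX, Nat.card_eq_fintype_card, Fintype.card_subtype]
  have hKX : K ≤ MulAction.stabilizer G X := by
    intro g hg
    rw [MulAction.mem_stabilizer_iff]
    refine Finset.eq_of_subset_of_card_le (fun y hy => ?_) (by rw [Finset.card_smul_finset])
    obtain ⟨x, hx, rfl⟩ := Finset.mem_smul_finset.1 hy
    simp only [hX, Finset.mem_filter, Finset.mem_univ, true_and, smul_eq_mul] at hx ⊢
    exact K.mul_mem hg hx
  have hXA : X * subsetProds v A = subsetProds v A := by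
    refine Finset.Subset.antisymm (fun y hy => ?_) (fun y hy => ?_)
    · obtain ⟨x, hx, z, hz, rfl⟩ := Finset.mem_mul.1 hy
      simp only [hX, Finset.mem_filter, Finset.mem_univ, true_and] at hx
      have := MulAction.mem_stabilizer_iff.1 hx
      rw [← this]
      exact Finset.smul_mem_smul_finset hz
    · exact Finset.mem_mul.2 ⟨1, by simp [hX, K.one_mem], y, hy, one_mul y⟩
  obtain ⟨W, hW, hst, hcard⟩ := exists_subset_stabilizing hKX v N
  have hfac : X * subsetProds v W * subsetProds v (A \ W) = subsetProds v A := by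
    rw [mul_assoc, ← subsetProds_union Finset.disjoint_sdiff,
      Finset.union_sdiff_of_subset (hW.trans hNA), hXA]
  -- A term of `N` left over would stabilize a factor of `subsetProds v A`, hence that set itself,
  -- and so lie in `K`.
  have hWN : W = N := by
    refine hW.antisymm fun i hi => ?_
    by_contra hiW
    have := stabilizer_le_stabilizer_mul _ (subsetProds v (A \ W))
      (hst i (Finset.mem_sdiff.2 ⟨hi, hiW⟩))
    rw [hfac] at this
    exact hN i hi this
  have hle := Finset.card_le_card_mul_right (s := X * subsetProds v W)
    (t := subsetProds v (A \ W)) ⟨_, prod_mem_subsetProds _⟩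
  rw [hfac] at hle
  rw [hXcard, hWN] at hcard
  rw [hWN] at hle
  linarith

end SubsetProds

/-! ### Product-one subsequences and the Davenport constant -/

section Davenport

open scoped Pointwise

theorem exists_prod_eq_one_of_davenport_le {ι G : Type*} [CommGroup G] [Finite G] (u : ι → G)
    (s : Finset ι) (hs : davenport G ≤ s.card) :
    ∃ t ⊆ s, t.Nonempty ∧ ∏ i ∈ t, u i = 1 := by
  classical
  obtain ⟨s', hs', hcard⟩ := Finset.exists_subset_card_eq hs
  obtain ⟨r, hr0, hr, hr1⟩ := (davenport_isLeast G).1.2 (s'.toList.map u) (by simp [hcard])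
  obtain ⟨r', hr', rfl⟩ := List.sublist_map_iff.1 hr
  have hnd : r'.Nodup := hr'.nodup (Finset.nodup_toList _)
  refine ⟨r'.toFinset, fun i hi => hs' ?_, ?_, ?_⟩
  · exact Finset.mem_toList.1 (hr'.subset (List.mem_toFinset.1 hi))
  · rw [List.toFinset_nonempty_iff]
    rintro rfl
    exact hr0 rfl
  · rw [List.prod_toFinset _ hnd, hr1]

theorem exists_list_not_hasTrivialSubproduct (G : Type*) [CommGroup G] [Finite G] :
    ∃ l : List G, l.length + 1 = davenport G ∧ ¬ HasTrivialSubproduct l := by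
  have hpos := (davenport_isLeast G).1.1
  rcases Nat.eq_or_lt_of_le hpos with h | h
  · refine ⟨[], by simpa using h, ?_⟩
    rintro ⟨t, ht, hs, -⟩
    exact ht (List.sublist_nil.1 hs)
  · by_contra! hcon
    have := (davenport_isLeast G).2 (show davenport G - 1 ∈ _ from
      ⟨by omega, fun l hl => hcon l (by omega)⟩)
    omega

/-- A product-one free sequence over `U` with terms in the kernel of `U → G ⧸ K` can be prolonged
by `[G : K] - 1` terms if `G ⧸ K` is cyclic. -/
theorem card_add_index_le_davenport {ι U G : Type*} [CommGroup U] [Finite U] [CommGroup G]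
    [Finite G] [IsCyclic G] (π : U →* G) (hπ : Function.Surjective π) (K : Subgroup G) (u : ι → U)
    (s : Finset ι) (hsK : ∀ i ∈ s, π (u i) ∈ K)
    (hs : ∀ t ⊆ s, ∏ i ∈ t, u i = 1 → t = ∅) :
    s.card + K.index ≤ davenport U := by
  classical
  by_contra! hlt
  have hidx : 0 < K.index := Nat.pos_of_ne_zero K.index_ne_zero_of_finite
  obtain ⟨g, hg⟩ := IsCyclic.exists_generator (α := G)
  obtain ⟨x, rfl⟩ := hπ g
  have hord : ∀ r, (π x) ^ r ∈ K → K.index ∣ r := by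
    intro r hr
    have h1 : orderOf ((π x : G) : G ⧸ K) = K.index := by
      rw [Subgroup.index_eq_card]
      refine orderOf_eq_card_of_forall_mem_zpowers fun y => ?_
      obtain ⟨y, rfl⟩ := QuotientGroup.mk_surjective y
      obtain ⟨m, rfl⟩ := hg y
      exact ⟨m, rfl⟩
    rw [← h1]
    refine orderOf_dvd_of_pow_eq_one ?_
    rw [← QuotientGroup.mk_pow]
    exact (QuotientGroup.eq_one_iff _).2 hr
  obtain ⟨t, ht, htne, ht1⟩ := exists_prod_eq_one_of_davenport_le
    (Sum.elim u fun _ : Fin (K.index - 1) => x) (s.disjSum Finset.univ)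
    (by rw [Finset.card_disjSum, Finset.card_univ, Fintype.card_fin]; omega)
  have hsub : t.toLeft ⊆ s := fun i hi => by
    have := ht (Finset.mem_toLeft.1 hi)
    simpa using this
  rw [← Finset.toLeft_disjSum_toRight (u := t), Finset.prod_disjSum] at ht1
  simp only [Sum.elim_inl, Sum.elim_inr, Finset.prod_const] at ht1
  -- Modulo `K` only the copies of `x` survive, so their number is a multiple of the index; at most
  -- index - 1 are available.
  have hr : t.toRight.card = 0 := by
    have hle : t.toRight.card ≤ K.index - 1 := by
      simpa using Finset.card_le_univ t.toRight
    have hmem : (π x) ^ t.toRight.card ∈ K := by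
      have h2 := congrArg π ht1
      rw [map_mul, map_pow, map_one, map_prod] at h2
      rw [eq_inv_of_mul_eq_one_right h2]
      exact K.inv_mem (K.prod_mem fun i hi => hsK i (hsub hi))
    refine Nat.eq_zero_of_dvd_of_lt (hord _ hmem) (by omega)
  rw [hr, pow_zero, mul_one] at ht1
  have hl := hs _ hsub ht1
  rw [Finset.card_eq_zero] at hr
  rw [← Finset.toLeft_disjSum_toRight (u := t), hl, hr] at htne
  simp at htne

/-- Let `A` be a product-one free sequence over `U`, and `B` a sequence over the cyclic quotient `G`
of `U`. If together they have at least `D(U) + k - 1` terms, then they have a subsequence with at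
least `k` terms from `B` whose product in `G` is one. -/
theorem exists_prod_eq_one_of_davenport_add_le {ι U G : Type*} [DecidableEq ι] [CommGroup U]
    [Finite U] [CommGroup G] [Finite G] [IsCyclic G] (π : U →* G) (hπ : Function.Surjective π)
    (u : ι → U) (v : ι → G) (A B : Finset ι) (hAB : Disjoint A B)
    (huv : ∀ i ∈ A, v i = π (u i)) (hA : ∀ t ⊆ A, ∏ i ∈ t, u i = 1 → t = ∅) (k : ℕ)
    (hk : davenport U + k ≤ A.card + B.card + 1) :
    ∃ J ⊆ A ∪ B, ∏ i ∈ J, v i = 1 ∧ k ≤ (J ∩ B).card := by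
  classical
  set K := MulAction.stabilizer G (subsetProds v A) with hK
  set N := A.filter (v · ∉ K) with hN
  have h1 := card_stabilizer_mul_le_card_subsetProds v A N (Finset.filter_subset _ _)
    (fun i hi => (Finset.mem_filter.1 hi).2)
  have h2 := card_add_index_le_davenport π hπ K u (A.filter (v · ∈ K))
    (fun i hi => by
      rw [Finset.mem_filter] at hi
      rw [← huv i hi.1]
      exact hi.2)
    (fun t ht => hA t (ht.trans (Finset.filter_subset _ _)))
  have h3 : (A.filter (v · ∈ K)).card + N.card = A.card :=
    Finset.card_filter_add_card_filter_not _
  obtain ⟨W, hW, hst, hcard⟩ := exists_subset_stabilizing (le_refl K) v B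
  have h4 : (subsetProds v A * subsetProds v W).card ≤ Nat.card K * K.index := by
    rw [K.card_mul_index]
    have := Fintype.ofFinite G
    rw [Nat.card_eq_fintype_card]
    exact Finset.card_le_univ _
  have h5 : N.card + 1 + W.card ≤ K.index := by
    refine Nat.le_of_mul_le_mul_left ?_ (Nat.card_pos (α := K))
    rw [← hK] at h1
    linarith
  -- The terms of `B \ W` stabilize this set, so multiplying by them does not leave it.
  have h6 : ∏ i ∈ A ∪ B, v i ∈ subsetProds v A * subsetProds v W := by
    have h : ∏ i ∈ A ∪ B, v i =
        (∏ i ∈ B \ W, v i) • ((∏ i ∈ A, v i) * ∏ i ∈ W, v i) := by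
      rw [Finset.prod_union hAB, ← Finset.prod_sdiff hW, smul_eq_mul]
      exact mul_left_comm _ _ _
    have hs : ∏ i ∈ B \ W, v i ∈
        MulAction.stabilizer G (subsetProds v A * subsetProds v W) :=
      Subgroup.prod_mem _ hst
    rw [h, ← MulAction.mem_stabilizer_iff.1 hs]
    exact Finset.smul_mem_smul_finset
      (Finset.mul_mem_mul (prod_mem_subsetProds A) (prod_mem_subsetProds W))
  rw [← subsetProds_union (hAB.mono_right hW), mem_subsetProds] at h6
  obtain ⟨Z, hZ, hZprod⟩ := h6
  refine ⟨(A ∪ B) \ Z, Finset.sdiff_subset, ?_, ?_⟩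
  · rw [← Finset.prod_sdiff (hZ.trans (Finset.union_subset_union_right hW))] at hZprod
    exact right_eq_mul.1 hZprod
  · have : B \ W ⊆ ((A ∪ B) \ Z) ∩ B := by
      intro i hi
      rw [Finset.mem_sdiff] at hi
      simp only [Finset.mem_inter, Finset.mem_sdiff, Finset.mem_union]
      refine ⟨⟨Or.inr hi.1, fun hiZ => ?_⟩, hi.1⟩
      rcases Finset.mem_union.1 (hZ hiZ) with h | h
      · exact Finset.disjoint_left.1 hAB h hi.1
      · exact hi.2 h
    have h7 := Finset.card_le_card this
    rw [Finset.card_sdiff_of_subset hW] at h7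
    have h8 := Finset.card_le_card hW
    omega

end Davenport

/-! ### Idempotent subproducts of lists -/

theorem List.foldl_mul_eq_mul_prod {M : Type*} [Monoid M] (a : M) (t : List M) :
    t.foldl (· * ·) a = a * t.prod := by
  induction t generalizing a with
  | nil => simp
  | cons b t ih => rw [List.foldl_cons, ih, List.prod_cons, mul_assoc]

theorem hasIdempotentSubproduct_iff {R : Type*} [CommRing R] {l : List R} :
    HasIdempotentSubproduct l ↔ ∃ t ≠ [], t.Sublist l ∧ IsIdempotentElem t.prod := by
  constructor
  · rintro ⟨a, t, h, hi⟩
    refine ⟨a :: t, by simp, h, ?_⟩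
    rw [List.prod_cons, ← List.foldl_mul_eq_mul_prod]
    exact hi
  · rintro ⟨_ | ⟨a, t⟩, h0, h, hi⟩
    · exact absurd rfl h0
    · refine ⟨a, t, h, ?_⟩
      rw [List.prod_cons, ← List.foldl_mul_eq_mul_prod] at hi
      exact hi

theorem hasIdempotentSubproduct_of_finset {R : Type*} [CommRing R] {l : List R}
    {J : Finset (Fin l.length)} (hJ : J.Nonempty)
    (h : IsIdempotentElem (∏ i ∈ J, l.get i)) : HasIdempotentSubproduct l := by
  classical
  rw [hasIdempotentSubproduct_iff]
  set r := (List.finRange l.length).filter (· ∈ J) with hr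
  have hrJ : r.toFinset = J := by ext; simp [hr]
  refine ⟨r.map l.get, ?_, ?_, ?_⟩
  · rw [← hrJ, List.toFinset_nonempty_iff] at hJ
    simpa using hJ
  · have h1 : (r.map l.get).Sublist ((List.finRange l.length).map l.get) :=
      List.filter_sublist.map _
    rwa [List.map_get_finRange] at h1
  · rwa [← List.prod_toFinset _ ((List.nodup_finRange _).filter _), hrJ]

theorem erdosBurgess_eq {S : Type*} [Semigroup S] {N : ℕ} (hN : 0 < N)
    (h : ∀ l : List S, l.length = N → HasIdempotentSubproduct l)
    (h' : ∃ l : List S, l.length + 1 = N ∧ ¬ HasIdempotentSubproduct l) :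
    erdosBurgess S = N := by
  refine IsLeast.csInf_eq ⟨⟨N, ⟨hN, h⟩, rfl⟩, ?_⟩
  rintro _ ⟨m, ⟨-, hm⟩, rfl⟩
  obtain ⟨l, hl, hno⟩ := h'
  simp only [Nat.cast_le]
  by_contra! hlt
  obtain ⟨a, t, hs, hi⟩ := hm (l.take m) (by rw [List.length_take]; omega)
  exact hno ⟨a, t, hs.trans (List.take_sublist _ _), hi⟩

/-! ### Residues modulo prime powers and their products -/

theorem ZMod.natCast_dvd_of_not_isUnit {p k : ℕ} (hp : p.Prime) {x : ZMod (p ^ k)}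
    (hx : ¬ IsUnit x) : (p : ZMod (p ^ k)) ∣ x := by
  have : NeZero (p ^ k) := ⟨pow_ne_zero _ hp.ne_zero⟩
  rw [← ZMod.natCast_zmod_val x] at hx ⊢
  rw [ZMod.isUnit_iff_coprime] at hx
  refine Nat.cast_dvd_cast ?_
  by_contra h
  exact hx (((Nat.Prime.coprime_iff_not_dvd hp).2 h).symm.pow_right k)

theorem ZMod.prod_eq_zero_of_not_isUnit {ι : Type*} {p k : ℕ} (hp : p.Prime)
    (f : ι → ZMod (p ^ k)) (s : Finset ι) (hk : k ≤ s.card) (hs : ∀ i ∈ s, ¬ IsUnit (f i)) :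
    ∏ i ∈ s, f i = 0 := by
  have h : (p : ZMod (p ^ k)) ^ s.card ∣ ∏ i ∈ s, f i := by
    rw [← Finset.prod_const]
    exact Finset.prod_dvd_prod_of_dvd _ _ fun i hi => natCast_dvd_of_not_isUnit hp (hs i hi)
  have h0 : (p : ZMod (p ^ k)) ^ k = 0 := by
    rw [← Nat.cast_pow, ZMod.natCast_self]
  exact zero_dvd_iff.1 (h0 ▸ (pow_dvd_pow _ hk).trans h)

/-- If `Qˣ` is a cyclic quotient of `Rˣ`, products of `k` nonunits of `P` vanish, and at least
`D(Rˣ) + k - 1` terms of a sequence over `R` are units in `Q`, then some nonempty subproduct is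
idempotent in `P` and one in `Q`. -/
theorem exists_isIdempotentElem_prod {ι R P Q : Type*} [Fintype ι] [CommRing R] [CommRing P]
    [CommRing Q] [Finite Rˣ] [Finite Qˣ] [IsCyclic Qˣ] (φ : R →+* P) (ψ : R →+* Q)
    (hψ : Function.Surjective (Units.map (ψ : R →* Q)))
    (hlift : ∀ x : R, IsUnit (φ x) → IsUnit (ψ x) → ∃ u : Rˣ, φ u = φ x ∧ ψ u = ψ x)
    {k : ℕ} (hk : 1 ≤ k) (f : ι → R)
    (hP : ∀ s : Finset ι, k ≤ s.card → (∀ i ∈ s, ¬ IsUnit (φ (f i))) → ∏ i ∈ s, φ (f i) = 0)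
    (T : Finset ι) (hT : ∀ i ∈ T, IsUnit (ψ (f i))) (hcard : davenport Rˣ + k ≤ T.card + 1) :
    ∃ J : Finset ι, J.Nonempty ∧ IsIdempotentElem (φ (∏ i ∈ J, f i)) ∧
      ψ (∏ i ∈ J, f i) = 1 := by
  classical
  have hu : ∀ i, ∃ u : Rˣ, IsUnit (φ (f i)) → IsUnit (ψ (f i)) →
      φ u = φ (f i) ∧ ψ u = ψ (f i) := fun i => by
    by_cases h : IsUnit (φ (f i)) ∧ IsUnit (ψ (f i))
    · obtain ⟨u, hu⟩ := hlift _ h.1 h.2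
      exact ⟨u, fun _ _ => hu⟩
    · exact ⟨1, fun h1 h2 => absurd ⟨h1, h2⟩ h⟩
  choose u hu using hu
  have hv : ∀ i, ∃ v : Qˣ, i ∈ T → (v : Q) = ψ (f i) := fun i => by
    by_cases h : i ∈ T
    · exact ⟨(hT i h).unit, fun _ => rfl⟩
    · exact ⟨1, fun h1 => absurd h1 h⟩
  choose v hv using hv
  set A := T.filter fun i => IsUnit (φ (f i)) with hA
  set B := T.filter fun i => ¬ IsUnit (φ (f i)) with hB
  have hAB : A.card + B.card = T.card := Finset.card_filter_add_card_filter_not _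
  have huA : ∀ i ∈ A, φ (u i) = φ (f i) ∧ ψ (u i) = ψ (f i) := fun i hi => by
    rw [hA, Finset.mem_filter] at hi
    exact hu i hi.2 (hT i hi.1)
  by_cases hfree : ∀ t ⊆ A, ∏ i ∈ t, u i = 1 → t = ∅
  · obtain ⟨J, hJ, hJ1, hJk⟩ := exists_prod_eq_one_of_davenport_add_le
      (Units.map (ψ : R →* Q)) hψ u v A B (Finset.disjoint_filter_filter_not _ _ _)
      (fun i hi => Units.ext (by
        rw [hv i (Finset.mem_filter.1 hi).1]
        exact (huA i hi).2.symm)) hfree k (by omega)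
    refine ⟨J, ?_, ?_, ?_⟩
    · rw [Finset.nonempty_iff_ne_empty]
      rintro rfl
      simp at hJk
      omega
    · have h0 : φ (∏ i ∈ J, f i) = 0 := by
        rw [map_prod, ← Finset.prod_sdiff (Finset.inter_subset_left : J ∩ B ⊆ J),
          hP _ hJk fun i hi => (Finset.mem_filter.1 (Finset.mem_inter.1 hi).2).2, mul_zero]
      rw [h0]
      exact IsIdempotentElem.zero
    · have hJT : J ⊆ T := hJ.trans
        (Finset.union_subset (Finset.filter_subset _ _) (Finset.filter_subset _ _))
      rw [map_prod, ← Finset.prod_congr rfl fun i hi => hv i (hJT hi), ← Units.coe_prod, hJ1,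
        Units.val_one]
  · push Not at hfree
    obtain ⟨t, ht, ht1, hne⟩ := hfree
    have h1 : ((∏ i ∈ t, u i : Rˣ) : R) = 1 := by rw [ht1, Units.val_one]
    rw [Units.coe_prod] at h1
    refine ⟨t, hne, ?_, ?_⟩
    · rw [map_prod, ← Finset.prod_congr rfl fun i hi => (huA i (ht hi)).1, ← map_prod, h1,
        map_one]
      exact IsIdempotentElem.one
    · rw [map_prod, ← Finset.prod_congr rfl fun i hi => (huA i (ht hi)).2, ← map_prod, h1,
        map_one]

/-- If `i` were positive, the `k`-th power would vanish; an idempotent equals that power, forcing `p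
^ i = 0` against `i < k`. -/
theorem ZMod.eq_zero_of_isIdempotentElem_pow_mul {p k i : ℕ} (hp : p.Prime) (hik : i < k)
    {w : ZMod (p ^ k)} (hw : IsUnit w)
    (h : IsIdempotentElem ((p : ZMod (p ^ k)) ^ i * w)) : i = 0 := by
  by_contra hi
  have h0 : (p : ZMod (p ^ k)) ^ k = 0 := by
    rw [← Nat.cast_pow, ZMod.natCast_self]
  have h1 : ((p : ZMod (p ^ k)) ^ i * w) ^ k = 0 := by
    rw [mul_pow, ← pow_mul, mul_comm i k, pow_mul, h0, zero_pow hi, zero_mul]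
  obtain ⟨m, rfl⟩ : ∃ m, k = m + 1 := ⟨k - 1, by omega⟩
  rw [h.pow_succ_eq, hw.mul_left_eq_zero, ← Nat.cast_pow, ZMod.natCast_eq_zero_iff,
    Nat.pow_dvd_pow_iff_le_right hp.one_lt] at h1
  omega

theorem ZMod.isUnit_castHom_mul {a b n : ℕ} [NeZero n] (ha : a ∣ n) (hb : b ∣ n) (hab : a * b ∣ n)
    {x : ZMod n} (hxa : IsUnit (ZMod.castHom ha (ZMod a) x))
    (hxb : IsUnit (ZMod.castHom hb (ZMod b) x)) :
    IsUnit (ZMod.castHom hab (ZMod (a * b)) x) := by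
  rw [← ZMod.natCast_zmod_val x, map_natCast, ZMod.isUnit_iff_coprime] at *
  exact hxa.mul_right hxb

/-- Units lift along `ZMod n → ZMod (a * b)`. The element `x` itself need not be a unit: in the
application it may be even. -/
theorem ZMod.exists_unit_castHom_eq {a b n : ℕ} [NeZero n] (ha : a ∣ n) (hb : b ∣ n)
    (hab : a * b ∣ n) {x : ZMod n} (hxa : IsUnit (ZMod.castHom ha (ZMod a) x))
    (hxb : IsUnit (ZMod.castHom hb (ZMod b) x)) :
    ∃ u : (ZMod n)ˣ, ZMod.castHom ha (ZMod a) u = ZMod.castHom ha (ZMod a) x ∧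
      ZMod.castHom hb (ZMod b) u = ZMod.castHom hb (ZMod b) x := by
  obtain ⟨u, hu⟩ := ZMod.unitsMap_surjective hab (isUnit_castHom_mul ha hb hab hxa hxb).unit
  have hu' : ZMod.castHom hab (ZMod (a * b)) u = ZMod.castHom hab (ZMod (a * b)) x :=
    congrArg Units.val hu
  have key : ∀ {c : ℕ} (hc : c ∣ a * b) (y : ZMod n), ZMod.castHom (hc.trans hab) (ZMod c) y =
      ZMod.castHom hc (ZMod c) (ZMod.castHom hab (ZMod (a * b)) y) := fun hc y =>
    RingHom.congr_fun (Subsingleton.elim (ZMod.castHom (hc.trans hab) (ZMod _))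
      ((ZMod.castHom hc (ZMod _)).comp (ZMod.castHom hab (ZMod (a * b))))) y
  exact ⟨u, by rw [key (Dvd.intro _ rfl), hu', ← key], by rw [key (Dvd.intro_left _ rfl), hu', ← key]⟩

theorem ZMod.isIdempotentElem_of_castHom {a b : ℕ} (h2a : Nat.Coprime 2 a) (h2b : Nat.Coprime 2 b)
    (hab : Nat.Coprime a b) (ha : a ∣ 2 * a * b) (hb : b ∣ 2 * a * b) [NeZero (2 * a * b)]
    {e : ZMod (2 * a * b)} (hea : IsIdempotentElem (ZMod.castHom ha (ZMod a) e))
    (heb : IsIdempotentElem (ZMod.castHom hb (ZMod b) e)) : IsIdempotentElem e := by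
  have h2 : 2 ∣ 2 * a * b := ⟨a * b, by ring⟩
  have he2 : IsIdempotentElem (ZMod.castHom h2 (ZMod 2) e) := by
    have : ∀ x : ZMod 2, x * x = x := by decide
    exact this _
  have key : ∀ {c : ℕ} (hc : c ∣ 2 * a * b), IsIdempotentElem (ZMod.castHom hc (ZMod c) e) →
      c ∣ (e * e - e).val := by
    intro c hc h
    rw [← ZMod.natCast_eq_zero_iff, ← map_natCast (ZMod.castHom hc (ZMod c)),
      ZMod.natCast_zmod_val, map_sub, map_mul, h.eq, sub_self]
  have h : (((e * e - e).val : ℕ) : ZMod (2 * a * b)) = 0 := by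
    rw [ZMod.natCast_eq_zero_iff]
    exact Nat.Coprime.mul_dvd_of_dvd_of_dvd (h2b.mul_left hab)
      (h2a.mul_dvd_of_dvd_of_dvd (key h2 he2) (key ha hea)) (key hb heb)
  rw [ZMod.natCast_zmod_val] at h
  exact sub_eq_zero.1 h

/-! ### The lower bound -/

/-- Appending copies of `p` and `q` to a long product-one free sequence of units gives a long
sequence without idempotent subproducts. -/
theorem exists_list_not_hasIdempotentSubproduct {p q k l n : ℕ} [Finite (ZMod n)ˣ] (hp : p.Prime)
    (hq : q.Prime) (hpq : p ≠ q) (hk : 1 ≤ k) (hl : 1 ≤ l) (hpn : p ^ k ∣ n) (hqn : q ^ l ∣ n) :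
    ∃ L : List (ZMod n), L.length + 1 = davenport (ZMod n)ˣ + (k - 1) + (l - 1) ∧
      ¬ HasIdempotentSubproduct L := by
  obtain ⟨U, hU, hfree⟩ := exists_list_not_hasTrivialSubproduct (ZMod n)ˣ
  refine ⟨U.map (↑) ++ (List.replicate (k - 1) (p : ZMod n) ++ List.replicate (l - 1) (q : ZMod n)),
    by simp; omega, ?_⟩
  rw [hasIdempotentSubproduct_iff]
  rintro ⟨t, ht0, ht, hid⟩
  obtain ⟨t1, t2, rfl, ht1, ht2⟩ := List.sublist_append_iff.1 ht
  obtain ⟨t3, t4, rfl, ht3, ht4⟩ := List.sublist_append_iff.1 ht2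
  obtain ⟨i, hi, rfl⟩ := List.sublist_replicate_iff.1 ht3
  obtain ⟨j, hj, rfl⟩ := List.sublist_replicate_iff.1 ht4
  obtain ⟨r, hr, rfl⟩ := List.sublist_map_iff.1 ht1
  have hprod : (r.map (fun x : (ZMod n)ˣ => (x : ZMod n))).prod = (r.prod : (ZMod n)ˣ) :=
    (map_list_prod (Units.coeHom (ZMod n)) r).symm
  rw [List.prod_append, List.prod_append, List.prod_replicate, List.prod_replicate, hprod] at hid
  have hunit : ∀ {a b : ℕ} (m : ℕ), a.Prime → b.Prime → a ≠ b → IsUnit (a : ZMod (b ^ m)) :=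
    fun m ha hb hab => (ZMod.isUnit_iff_coprime _ _).2
      (((Nat.coprime_primes ha hb).2 hab).pow_right m)
  have hi0 : i = 0 := by
    have h := hid.map (ZMod.castHom hpn (ZMod (p ^ k)))
    rw [map_mul, map_mul, map_pow, map_pow, map_natCast, map_natCast, mul_left_comm] at h
    exact ZMod.eq_zero_of_isIdempotentElem_pow_mul hp (by omega)
      ((r.prod.isUnit.map _).mul ((hunit k hq hp hpq.symm).pow j)) h
  have hj0 : j = 0 := by
    have h := hid.map (ZMod.castHom hqn (ZMod (q ^ l)))
    rw [map_mul, map_mul, map_pow, map_pow, map_natCast, map_natCast, ← mul_assoc, mul_comm] at h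
    exact ZMod.eq_zero_of_isIdempotentElem_pow_mul hq (by omega)
      ((r.prod.isUnit.map _).mul ((hunit l hp hq hpq).pow i)) h
  subst hi0 hj0
  refine hfree ⟨r, ?_, hr, ?_⟩
  · rintro rfl
    simp at ht0
  · rw [pow_zero, pow_zero, mul_one, mul_one] at hid
    -- An idempotent unit is 1.
    exact Units.ext (r.prod.isUnit.mul_left_cancel (by rw [hid.eq]; simp))

/-! ### The formula -/

theorem corollary4p6 (p q k l : ℕ) (hp : p.Prime) (hq : q.Prime) (hp_odd : Odd p) (hq_odd : Odd q)
    (hpq : p ≠ q) (hk : 1 ≤ k) (hl : 1 ≤ l) :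
    ringErdosBurgess (ZMod (2 * p ^ k * q ^ l)) =
      ((davenport (ZMod (2 * p ^ k * q ^ l))ˣ + (k - 1) + (l - 1) : ℕ) : ℕ∞) := by
  classical
  have hpn : p ^ k ∣ 2 * p ^ k * q ^ l := ⟨2 * q ^ l, by ring⟩
  have hqn : q ^ l ∣ 2 * p ^ k * q ^ l := ⟨2 * p ^ k, by ring⟩
  have hpqn : p ^ k * q ^ l ∣ 2 * p ^ k * q ^ l := ⟨2, by ring⟩
  have hqpn : q ^ l * p ^ k ∣ 2 * p ^ k * q ^ l := ⟨2, by ring⟩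
  have hppos := hp.pos
  have hqpos := hq.pos
  have : NeZero (2 * p ^ k * q ^ l) := ⟨by positivity⟩
  have hcyc : ∀ (r m : ℕ), r.Prime → Odd r → IsCyclic (ZMod (r ^ m))ˣ := fun r m hr hodd =>
    ZMod.isCyclic_units_of_prime_pow r hr (by rintro rfl; exact absurd hodd (by decide)) m
  have := hcyc p k hp hp_odd
  have := hcyc q l hq hq_odd
  have hidem : ∀ {e : ZMod (2 * p ^ k * q ^ l)},
      IsIdempotentElem (ZMod.castHom hpn (ZMod (p ^ k)) e) →
      IsIdempotentElem (ZMod.castHom hqn (ZMod (q ^ l)) e) → IsIdempotentElem e :=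
    ZMod.isIdempotentElem_of_castHom (Nat.coprime_two_left.2 hp_odd.pow)
      (Nat.coprime_two_left.2 hq_odd.pow) (Nat.coprime_pow_primes _ _ hp hq hpq) hpn hqn
  have hpos := (davenport_isLeast (ZMod (2 * p ^ k * q ^ l))ˣ).1.1
  refine erdosBurgess_eq (by omega) (fun L hL => ?_)
    (exists_list_not_hasIdempotentSubproduct hp hq hpq hk hl hpn hqn)
  set NP := Finset.univ.filter fun i => ¬ IsUnit (ZMod.castHom hpn (ZMod (p ^ k)) (L.get i))
    with hNP
  set NQ := Finset.univ.filter fun i => ¬ IsUnit (ZMod.castHom hqn (ZMod (q ^ l)) (L.get i))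
    with hNQ
  have hcP : NPᶜ.card = L.length - NP.card := by rw [Finset.card_compl, Fintype.card_fin]
  have hcQ : NQᶜ.card = L.length - NQ.card := by rw [Finset.card_compl, Fintype.card_fin]
  -- At most `l - 1` nonunits modulo `q ^ l` leave the `D + k - 1` units needed.
  rcases lt_or_ge NQ.card l with hlt | hQ
  · obtain ⟨J, hJ, h1, h2⟩ := exists_isIdempotentElem_prod (ZMod.castHom hpn (ZMod (p ^ k)))
      (ZMod.castHom hqn (ZMod (q ^ l))) (ZMod.unitsMap_surjective hqn)
      (fun x => ZMod.exists_unit_castHom_eq hpn hqn hpqn) hk L.get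
      (fun s => ZMod.prod_eq_zero_of_not_isUnit hp _ s) NQᶜ
      (fun i hi => by
        simpa only [hNQ, Finset.mem_compl, Finset.mem_filter, Finset.mem_univ, true_and,
          not_not] using hi) (by omega)
    exact hasIdempotentSubproduct_of_finset hJ (hidem h1 (by rw [h2]; exact IsIdempotentElem.one))
  rcases lt_or_ge NP.card k with hlt | hP
  · obtain ⟨J, hJ, h1, h2⟩ := exists_isIdempotentElem_prod (ZMod.castHom hqn (ZMod (q ^ l)))
      (ZMod.castHom hpn (ZMod (p ^ k))) (ZMod.unitsMap_surjective hpn)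
      (fun x => ZMod.exists_unit_castHom_eq hqn hpn hqpn) hl L.get
      (fun s => ZMod.prod_eq_zero_of_not_isUnit hq _ s) NPᶜ
      (fun i hi => by
        simpa only [hNP, Finset.mem_compl, Finset.mem_filter, Finset.mem_univ, true_and,
          not_not] using hi) (by omega)
    exact hasIdempotentSubproduct_of_finset hJ (hidem (by rw [h2]; exact IsIdempotentElem.one) h1)
  have hzero : ∀ {r m : ℕ} (hr : r.Prime) (hn : r ^ m ∣ 2 * p ^ k * q ^ l)
      (N : Finset (Fin L.length)), m ≤ N.card →
      (∀ i ∈ N, ¬ IsUnit (ZMod.castHom hn (ZMod (r ^ m)) (L.get i))) →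
      IsIdempotentElem (ZMod.castHom hn (ZMod (r ^ m)) (∏ i, L.get i)) := by
    intro r m hr hn N hN hun
    rw [map_prod, ← Finset.prod_sdiff (Finset.subset_univ N),
      ZMod.prod_eq_zero_of_not_isUnit hr _ N hN hun, mul_zero]
    exact IsIdempotentElem.zero
  refine hasIdempotentSubproduct_of_finset (J := Finset.univ) ⟨⟨0, by omega⟩, Finset.mem_univ _⟩
    (hidem (hzero hp hpn NP hP fun i hi => (Finset.mem_filter.1 hi).2)
      (hzero hq hqn NQ hQ fun i hi => (Finset.mem_filter.1 hi).2))
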